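/- Let $R$ be a commutative noetherian ring, $J\subset R$ an ideal, and let $\mathcal C$ be an $R$-linear noetherian abelian category, i.e. an $R$-linear abelian category that is essentially small and in which every object is noetherian. Let $\operatorname{Pro}(\mathcal C)$ be the ($R$-linear abelian) category of pro-objects of $\mathcal C$: its objects are the small cofiltered inverse systems $(M_\alpha)_\alpha$ in $\mathcal C$, with $$\operatorname{Hom}_{\operatorname{Pro}(\mathcal C)}((M_\alpha)_\alpha,(N_\beta)_\beta)=\varprojlim_\beta\varinjlim_\alpha\operatorname{Hom}_{\mathcal C}(M_\alpha,N_\beta),$$ and $\mathcal C$ is regarded as the full subcategory of objects isomorphic to constant systems. For $M\in\operatorname{Pro}(\mathcal C)$ and an ideal $I=(r_1,\dots,r_p)$ of $R$, let $M/MI$ be the cokernel of $(r_1,\dots,r_p)\colon M^p\to M$. Let $\widehat{\mathcal C}$ be the full subcategory of $\operatorname{Pro}(\mathcal C)$ consisting of those $M$ such that $M/MJ^n\in\mathcal C$ for all $n\ge 0$ and such that the canonical morphism $M\to\varprojlim_n M/MJ^n$ (limit in $\operatorname{Pro}(\mathcal C)$) is an isomorphism. Then $\widehat{\mathcal C}$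 is an abelian subcategory of $\operatorname{Pro}(\mathcal C)$ (it is abelian and its inclusion into $\operatorname{Pro}(\mathcal C)$ is exact), and $\widehat{\mathcal C}$ is noetherian, i.e. it is essentially small and each of its objects is noetherian. -/

import Mathlib

open CategoryTheory Limits Opposite

universe w v u u'

noncomputable section

namespace JAdicCompletion

/-! ### The abelian structure on ind-objects of an essentially small abelian category

Mathlib proves that `Ind S` is abelian when `S` is a small abelian category.  The declarations of
this section transport this to essentially small categories. -/

section Transfer

variable {D : Type u} [Category.{v} D] {S : Type u'} [Category.{v} S]

theorem isIndObject_comp (e : D ≌ S) {A : Sᵒᵖ ⥤ Type v} (hA : IsIndObject A) :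
    IsIndObject (e.functor.op ⋙ A) := by
  obtain ⟨⟨P⟩⟩ := hA
  let W := (Functor.whiskeringLeft Dᵒᵖ Sᵒᵖ (Type v)).obj e.functor.op
  let α : (P.F ⋙ e.inverse) ⋙ yoneda ≅ (P.F ⋙ yoneda) ⋙ W :=
    NatIso.ofComponents (fun i => NatIso.ofComponents (fun d =>
      ((e.toAdjunction.homEquiv d.unop (P.F.obj i)).toIso).symm)
      (by
        intro X Y f
        ext g
        simp [W, Equivalence.toAdjunction, Adjunction.homEquiv_counit]))
      (by
        intro X Y f
        ext d g
        simp [W, Adjunction.homEquiv_counit])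
  let hc := isColimitOfPreserves W P.coconeIsColimit
  let hc' := (IsColimit.precomposeHomEquiv α _).symm hc
  exact ⟨⟨IndObjectPresentation.ofCocone _ hc'⟩⟩

/-- Ind-objects of `S`, as presheaves, viewed as ind-objects of an equivalent category `D`. -/
def indTransfer (e : D ≌ S) : Ind S ⥤ Ind D :=
  ObjectProperty.lift _ (Ind.inclusion S ⋙
      (Functor.whiskeringLeft Dᵒᵖ Sᵒᵖ (Type v)).obj e.functor.op)
    (fun X => isIndObject_comp e X.isIndObject_inclusion_obj) ⋙ (Ind.equivalence D).inverse

instance (e : D ≌ S) : (indTransfer e).Full := by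
  unfold indTransfer; infer_instance

instance (e : D ≌ S) : (indTransfer e).Faithful := by
  unfold indTransfer; infer_instance

instance (e : D ≌ S) : (indTransfer e).EssSurj where
  mem_essImage X := by
    let Y : Ind S := (Ind.equivalence S).inverse.obj
      ⟨e.inverse.op ⋙ (Ind.inclusion D).obj X,
        isIndObject_comp e.symm X.isIndObject_inclusion_obj⟩
    let i₁ : (Ind.inclusion S).obj Y ≅ e.inverse.op ⋙ (Ind.inclusion D).obj X :=
      (ObjectProperty.ι _).mapIso ((Ind.equivalence S).counitIso.app _)
    let i₂ : e.functor.op ⋙ (Ind.inclusion S).obj Y ≅ (Ind.inclusion D).obj X :=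
      Functor.isoWhiskerLeft e.functor.op i₁ ≪≫
        (Functor.associator _ _ _).symm ≪≫
        Functor.isoWhiskerRight (NatIso.op e.unitIso) _ ≪≫ Functor.leftUnitor _
    refine ⟨Y, ⟨(Ind.inclusion.fullyFaithful (C := D)).preimageIso (?_ ≪≫ i₂)⟩⟩
    exact (ObjectProperty.ι _).mapIso ((Ind.equivalence D).counitIso.app _)

instance (e : D ≌ S) : (indTransfer e).IsEquivalence where

end Transfer

section AbelianInd

variable (D : Type u) [Category.{v} D] [Abelian D] [EssentiallySmall.{v} D]

instance : Preadditive (SmallModel.{v} D) :=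
  .ofFullyFaithful (equivSmallModel.{v} D).fullyFaithfulInverse

instance : HasFiniteProducts (SmallModel.{v} D) :=
  ⟨fun _ => Adjunction.hasLimitsOfShape_of_equivalence (equivSmallModel.{v} D).inverse⟩

instance : Abelian (SmallModel.{v} D) :=
  abelianOfEquivalence (equivSmallModel.{v} D).inverse

/-- The preadditive structure on ind-objects of an essentially small abelian category. -/
abbrev preadditiveInd : Preadditive (Ind D) :=
  .ofFullyFaithful (indTransfer (equivSmallModel.{v} D)).asEquivalence.fullyFaithfulInverse

/-- The abelian structure on ind-objects of an essentially small abelian category. -/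
abbrev abelianInd : Abelian (Ind D) :=
  letI := preadditiveInd D
  haveI : HasFiniteProducts (Ind D) := inferInstance
  abelianOfEquivalence (indTransfer (equivSmallModel.{v} D)).asEquivalence.inverse

end AbelianInd

/-! ### Pro-objects -/

/-- The category of pro-objects of `C`: the opposite of the category of ind-objects of `Cᵒᵖ`.
Its objects are the formal limits of small cofiltered systems in `C`, and its morphisms are
`Hom((M_α), (N_β)) = lim_β colim_α Hom(M_α, N_β)`. -/
def Pro (C : Type u) [Category.{v} C] : Type (max u (v + 1)) := (Ind Cᵒᵖ)ᵒᵖ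

instance (C : Type u) [Category.{v} C] : Category.{v} (Pro C) :=
  inferInstanceAs (Category.{v} (Ind Cᵒᵖ)ᵒᵖ)

namespace Pro

/-- The embedding of `C` in `Pro C` as the constant systems. -/
def of (C : Type u) [Category.{v} C] : C ⥤ Pro C := (Ind.yoneda (C := Cᵒᵖ)).rightOp

instance (C : Type u) [Category.{v} C] : (of C).Full :=
  inferInstanceAs (Ind.yoneda (C := Cᵒᵖ)).rightOp.Full

instance (C : Type u) [Category.{v} C] : (of C).Faithful :=
  inferInstanceAs (Ind.yoneda (C := Cᵒᵖ)).rightOp.Faithful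

theorem hom_ext {C : Type u} [Category.{v} C] {M N : Pro C} (f g : M ⟶ N)
    (h : ∀ (X : C) (t : N ⟶ (of C).obj X), f ≫ t = g ≫ t) : f = g := by
  apply Quiver.Hom.unop_inj
  refine Ind.isSeparating_range_yoneda _ _ fun Y hY t => ?_
  obtain ⟨X⟩ := hY
  exact congrArg Quiver.Hom.unop (h X.unop (Quiver.Hom.op t))

section

variable (C : Type u) [Category.{v} C] [Abelian C] [EssentiallySmall.{v} C]

instance : Abelian (Pro C) :=
  letI := abelianInd Cᵒᵖ
  inferInstanceAs (Abelian (Ind Cᵒᵖ)ᵒᵖ)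

instance : PreservesFiniteLimits (of C) :=
  preservesFiniteLimits_rightOp (Ind.yoneda (C := Cᵒᵖ))

instance : PreservesFiniteColimits (of C) :=
  haveI : PreservesFiniteLimits (Ind.yoneda (C := Cᵒᵖ)) := PreservesLimits.preservesFiniteLimits _
  preservesFiniteColimits_rightOp (Ind.yoneda (C := Cᵒᵖ))

instance : (of C).Additive :=
  Functor.additive_of_preserves_binary_products _

end

section Linear

variable {R : Type w} [CommRing R] {C : Type u} [Category.{v} C] [Abelian C] [Linear R C]

/-- Multiplication by `r` on a presheaf on `Cᵒᵖ`. -/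
def presheafScalar (r : R) (A : Cᵒᵖᵒᵖ ⥤ Type v) : A ⟶ A where
  app c := A.map (r • 𝟙 c.unop.unop).op.op
  naturality c d f := by
    rw [← A.map_comp, ← A.map_comp]
    congr 1
    apply Quiver.Hom.unop_inj
    apply Quiver.Hom.unop_inj
    simp

/-- Multiplication by `r` on an ind-object of `Cᵒᵖ`. -/
def indScalar (r : R) (X : Ind Cᵒᵖ) : X ⟶ X :=
  (Ind.inclusion Cᵒᵖ).preimage (presheafScalar r ((Ind.inclusion Cᵒᵖ).obj X))

theorem comp_indScalar (r : R) {X Y : Ind Cᵒᵖ} (f : X ⟶ Y) :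
    f ≫ indScalar r Y = indScalar r X ≫ f := by
  apply (Ind.inclusion Cᵒᵖ).map_injective
  rw [Functor.map_comp, Functor.map_comp, indScalar, indScalar, Functor.map_preimage,
    Functor.map_preimage]
  ext c : 2
  exact (((Ind.inclusion Cᵒᵖ).map f).naturality (r • 𝟙 c.unop.unop).op.op).symm

theorem indScalar_yoneda (r : R) (X : C) :
    indScalar r (Ind.yoneda.obj (op X)) = Ind.yoneda.map (r • 𝟙 X).op := by
  apply (Ind.inclusion Cᵒᵖ).map_injective
  rw [indScalar, Functor.map_preimage, ← cancel_mono (Ind.yonedaCompInclusion.hom.app (op X))]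
  refine Eq.trans ?_ (Ind.yonedaCompInclusion.hom.naturality (r • 𝟙 X).op).symm
  ext c : 2
  refine ((Ind.yonedaCompInclusion.hom.app (op X)).naturality (r • 𝟙 c.unop.unop).op.op).trans ?_
  change _ = (Ind.yonedaCompInclusion.hom.app (op X)).app c ≫
    (yoneda.map (r • 𝟙 X).op).app c
  congr 1
  ext g
  apply Quiver.Hom.unop_inj
  change g.unop ≫ (r • 𝟙 _) = (r • 𝟙 X) ≫ g.unop
  simp

/-- Multiplication by `r` on a pro-object. -/
def scalar (r : R) (M : Pro C) : M ⟶ M :=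
  Quiver.Hom.op (indScalar r (show (Ind Cᵒᵖ)ᵒᵖ from M).unop)

theorem scalar_comp (r : R) {M N : Pro C} (f : M ⟶ N) : scalar r M ≫ f = f ≫ scalar r N :=
  congrArg Quiver.Hom.op (comp_indScalar r (Quiver.Hom.unop f))

theorem scalar_of (r : R) (X : C) : scalar r ((of C).obj X) = (of C).map (r • 𝟙 X) :=
  congrArg Quiver.Hom.op (indScalar_yoneda r X)

theorem scalar_comp_of (r : R) {M : Pro C} {X : C} (t : M ⟶ (of C).obj X) :
    scalar r M ≫ t = t ≫ (of C).map (r • 𝟙 X) := by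
  rw [scalar_comp, scalar_of]

variable [EssentiallySmall.{v} C]

/-- Pro-objects of an `R`-linear category form an `R`-linear category. -/
instance : Linear R (Pro C) where
  homModule M N :=
    { smul r f := scalar r M ≫ f
      one_smul f := by
        refine Eq.trans (congrArg (· ≫ f) ?_) (Category.id_comp f)
        refine hom_ext _ _ fun X t => ?_
        rw [scalar_comp_of, one_smul, CategoryTheory.Functor.map_id, Category.comp_id,
          Category.id_comp]
      mul_smul r s f := by
        refine Eq.trans (congrArg (· ≫ f) ?_) (Category.assoc _ _ _)
        refine hom_ext _ _ fun X t => ?_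
        rw [Category.assoc, scalar_comp_of, scalar_comp_of, scalar_comp_of,
          Category.assoc, ← Functor.map_comp, Linear.comp_smul, Category.comp_id, mul_smul]
      smul_zero r := comp_zero
      smul_add r f g := Preadditive.comp_add _ _ _ _ _ _
      add_smul r s f := by
        refine Eq.trans (congrArg (· ≫ f) ?_) (Preadditive.add_comp _ _ _ _ _ _)
        refine hom_ext _ _ fun X t => ?_
        rw [Preadditive.add_comp, scalar_comp_of, scalar_comp_of, scalar_comp_of, add_smul,
          Functor.map_add, Preadditive.comp_add]
      zero_smul f := by
        refine Eq.trans (congrArg (· ≫ f) ?_) zero_comp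
        refine hom_ext _ _ fun X t => ?_
        rw [scalar_comp_of, zero_smul, Functor.map_zero, comp_zero, zero_comp] }
  smul_comp _ _ _ r f g := Category.assoc _ _ _
  comp_smul M N _ f r g := by
    change f ≫ scalar r N ≫ g = scalar r M ≫ f ≫ g
    rw [← Category.assoc, ← Category.assoc, scalar_comp]

instance : (of C).Linear R where
  map_smul {X Y} f r := by
    change _ = scalar r ((of C).obj X) ≫ (of C).map f
    rw [scalar_of, ← Functor.map_comp, Linear.smul_comp, Category.id_comp]

end Linear

end Pro

/-! ### Completion -/

section Quotient

attribute [local instance] Abelian.hasFiniteBiproducts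

variable {R : Type w} [CommRing R] [IsNoetherianRing R]
variable {D : Type u} [Category.{v} D] [Abelian D] [Linear R D]

/-- A finite set of generators of an ideal of a noetherian ring. -/
def gens (I : Ideal R) : Finset R := (IsNoetherian.noetherian I).choose

theorem span_gens (I : Ideal R) : Ideal.span (gens I : Set R) = I :=
  (IsNoetherian.noetherian I).choose_spec

/-- The morphism `(r₁, …, r_p) : M^p ⟶ M` given by generators `r₁, …, r_p` of `I`.
Its image is the subobject `MI` of `M`. -/
def genMap (I : Ideal R) (M : D) : (⨁ fun _ : gens I => M) ⟶ M :=
  biproduct.desc fun r => (r : R) • 𝟙 M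

/-- The quotient `M/MI = M ⊗ R/I`. -/
def quot (I : Ideal R) (M : D) : D := cokernel (genMap I M)

/-- The projection `M ⟶ M/MI`. -/
def quotπ (I : Ideal R) (M : D) : M ⟶ quot I M := cokernel.π (genMap I M)

instance (I : Ideal R) (M : D) : Epi (quotπ I M) :=
  inferInstanceAs (Epi (cokernel.π (genMap I M)))

theorem smul_quotπ {I : Ideal R} (M : D) {r : R} (hr : r ∈ I) : r • quotπ I M = 0 := by
  rw [← span_gens I] at hr
  induction hr using Submodule.span_induction with
  | mem x hx =>
    have h := congrArg (biproduct.ι (fun _ : gens I => M) ⟨x, hx⟩ ≫ ·)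
      (cokernel.condition (genMap I M))
    have h' := h.trans comp_zero
    simp only [genMap, biproduct.ι_desc_assoc, Linear.smul_comp, Category.id_comp] at h'
    exact h'
  | zero => exact zero_smul _ _
  | add x y _ _ hx hy => rw [add_smul, hx, hy, add_zero]
  | smul a x _ hx => rw [smul_eq_mul, mul_smul, hx, smul_zero]

/-- `M/MI` is the largest quotient of `M` that is annihilated by `I`. -/
def quotDesc {I : Ideal R} {M T : D} (f : M ⟶ T) (hf : ∀ r ∈ I, r • f = 0) : quot I M ⟶ T :=
  cokernel.desc (genMap I M) f (by
    apply biproduct.hom_ext'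
    intro r
    have hr : (r : R) ∈ I := (span_gens I).le (Ideal.subset_span r.2)
    simpa [genMap] using hf r hr)

@[simp]
theorem quotπ_desc {I : Ideal R} {M T : D} (f : M ⟶ T) (hf : ∀ r ∈ I, r • f = 0) :
    quotπ I M ≫ quotDesc f hf = f :=
  cokernel.π_desc _ _ _

/-- The inverse system `⋯ ⟶ M/MJ² ⟶ M/MJ ⟶ M/MJ⁰ = 0`. -/
def adicTower (J : Ideal R) (M : D) : ℕᵒᵖ ⥤ D where
  obj n := quot (J ^ n.unop) M
  map {m n} f := quotDesc (quotπ (J ^ n.unop) M) fun _ hr =>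
    smul_quotπ M (Ideal.pow_le_pow_right (leOfHom f.unop) hr)
  map_id n := by simp [← cancel_epi (quotπ _ M)]
  map_comp f g := by
    rw [← cancel_epi (quotπ _ M), quotπ_desc, ← Category.assoc, quotπ_desc, quotπ_desc]

/-- The canonical cone with vertex `M` over the system `(M/MJⁿ)ₙ`. -/
def adicCone (J : Ideal R) (M : D) : Cone (adicTower J M) where
  pt := M
  π :=
    { app n := quotπ (J ^ n.unop) M
      naturality m n f := by simp [adicTower] }

end Quotient

section Completion

variable {R : Type w} [CommRing R] [IsNoetherianRing R]

/-- The completion `Ĉ` of `C`, as a full subcategory of `Pro C`: it consists of the pro-objects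
`M` such that `M/MJⁿ` lies in `C` for all `n`, and such that the canonical morphism
`M ⟶ lim M/MJⁿ` is an isomorphism. -/
def completion (J : Ideal R) (C : Type u) [Category.{v} C] [Abelian C] [EssentiallySmall.{v} C]
    [Linear R C] : ObjectProperty (Pro C) := fun M =>
  (∀ n : ℕ, (Pro.of C).essImage (quot (J ^ n) M)) ∧ Nonempty (IsLimit (adicCone J M))

/-- A full subcategory `P` of an abelian category `A` is an abelian subcategory if it is closed
under isomorphisms, is an abelian category, and the inclusion `P ⟶ A` is exact. -/
structure IsAbelianSubcategory {A : Type u} [Category.{v} A] [Abelian A]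
    (P : ObjectProperty A) : Prop where
  closedUnderIsomorphisms : P.IsClosedUnderIsomorphisms
  abelian : Nonempty (Abelian P.FullSubcategory)
  preservesFiniteLimits : PreservesFiniteLimits P.ι
  preservesFiniteColimits : PreservesFiniteColimits P.ι

end Completion

end JAdicCompletion

end

/-!
The objects of `C` cogenerate `Pro C`, and they are cocompact: a morphism from the limit of a tower
to an object of `C` factors through a stage of the tower. It follows that `M` is the limit of its
tower `M/MJⁿ` exactly when it is separated, that is when `⋂ₙ MJⁿ = 0`
(`nonempty_isLimit_adicCone`), and also exactly when every morphism from `M` to an object of `C` is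
killed by a power of `J`. The first form passes to subobjects and the second to quotients, so
separatedness passes to arbitrary subobjects and quotients in `Pro C`. As `C` is closed under
kernels and cokernels in `Pro C`, and `M ↦ M/MJⁿ` is right exact, cokernels in `Pro C` of morphisms
of `Ĉ` lie in `Ĉ`. By factoring a morphism through its image, the case of kernels reduces to the
kernel `K` of an epimorphism `g : N ⟶ Q` of `Ĉ`; what has to be shown is that `K/KJᵐ` lies in `C`.

This is an Artin-Rees statement, and it is proved along the lines of the Hilbert basis theorem. Let
`r₁, …, r_p` generate `J`, enumerate the monomials `rᵃ` compatibly with the degree-lexicographic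
order, and let `I_k` be the ideal generated by the monomials of rank at least `k`. The filtration
of `N` by the `N I_k` is cofinal with the `J`-adic one, and its successive quotients are images of
`N/NJ` under multiplication by `rᵃ`. The initial subobject of `K` in multidegree `a` is
`{y | rᵃ y ∈ K + N I_{k+1}}`, where `k` is the rank of `a` (`InInitial`). It is the kernel of a
morphism from `N` to `Q/Q I_{k+1}` that factors through `N/NJ`, so it corresponds to a subobject of
a noetherian object of `C`, and it increases with `a`. By Dickson's lemma there is a degree beyond
which every initial subobject equals the one in some multidegree `a - eᵢ`
(`exists_degree_forall_eq`). Hence an element of `K ∩ N I_k` with `k` large is the sum of an element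
of `rᵢ (K ∩ N I_l)`, where `l` is the rank of `a - eᵢ`, and one of `K ∩ N I_{k+1}`
(`exists_sub_smul_comp_quotπ`). By induction on `m`, with a passage to the limit that uses that
`N/KJᵐ` is separated, `K ∩ N I_k ⊆ KJᵐ` for some `k` (`exists_forall_comp_quotπ_kernel`). So `K/KJᵐ`
is also `K'/K'Jᵐ` for `K' = ker (N/N I_k ⟶ Q/Q I_k)`, which lies in `C`.

The same device gives the ascending chain condition. For an ascending chain of subobjects of `N` in
`Ĉ`, the initial subobjects of all members in all multidegrees stabilize simultaneously
(`exists_forall_eq_of_monotone`), and a subobject is determined by its initial subobjects among the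
larger ones, as the quotient by it is separated (`comp_eq_zero_of_inInitial`). Finally `Ĉ` is
essentially small since each of its objects is the limit of a tower in `C`.

Elements of objects of abelian categories are replaced by generalized elements `x : A ⟶ M`, which
may be refined by precomposition with an epimorphism `A' ⟶ A`. In this language, `x` belongs to
`MI` when `x ≫ quotπ I M = 0`.
-/

noncomputable section

namespace JAdicCompletion

attribute [local instance] Abelian.hasFiniteBiproducts

/-! ### Towers of pro-objects -/

section Cocompact

variable {D : Type u} [Category.{v} D]

instance : PreservesColimitsOfShape ℕ (Ind.inclusion D) :=
  preservesColimitsOfShape_of_equiv (ULiftHomULiftCategory.equiv.{v, v} ℕ).symm _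

/-- Objects of `D` are compact in `Ind D`, in the case of sequential colimits. The colimit is
computed in presheaves, where this is the Yoneda lemma. -/
theorem exists_lift_of_isColimit {F : ℕ ⥤ Ind D} {c : Cocone F} (hc : IsColimit c) {X : D}
    (t : Ind.yoneda.obj X ⟶ c.pt) :
    ∃ (n : ℕ) (s : Ind.yoneda.obj X ⟶ F.obj n), s ≫ c.ι.app n = t := by
  let E := Ind.inclusion D ⋙ (evaluation _ _).obj (op X)
  let i := (Ind.yonedaCompInclusion (C := D)).app X
  have h1 := isColimitOfPreserves E hc
  obtain ⟨n, y, hy⟩ := Types.jointly_surjective _ h1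
    (yonedaEquiv (i.inv ≫ (Ind.inclusion D).map t))
  refine ⟨n, (Ind.inclusion D).preimage (i.hom ≫ yonedaEquiv.symm y), ?_⟩
  apply (Ind.inclusion D).map_injective
  rw [Functor.map_comp, Functor.map_preimage, Category.assoc, ← cancel_epi i.inv]
  rw [Iso.inv_hom_id_assoc]
  apply yonedaEquiv.injective
  rw [← hy, yonedaEquiv_comp, Equiv.apply_symm_apply]
  rfl

end Cocompact

namespace Pro

variable {C : Type u} [Category.{v} C] [Abelian C] [EssentiallySmall.{v} C]

instance : HasLimitsOfShape ℕᵒᵖ (Pro C) := by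
  have : HasColimitsOfSize.{0, 0} (Ind Cᵒᵖ) := hasColimitsOfSizeShrink.{0, 0, v, v} _
  exact inferInstanceAs (HasLimitsOfShape ℕᵒᵖ (Ind Cᵒᵖ)ᵒᵖ)

/-- Objects of `C` are cocompact in `Pro C`, in the case of limits of towers. -/
theorem exists_factor_of_isLimit {C : Type u} [Category.{v} C] {F : ℕᵒᵖ ⥤ Pro C}
    {c : Cone F} (hc : IsLimit c) {X : C} (t : c.pt ⟶ (of C).obj X) :
    ∃ (n : ℕ) (s : F.obj (op n) ⟶ (of C).obj X), c.π.app (op n) ≫ s = t := by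
  let F' : ℕᵒᵖ ⥤ (Ind Cᵒᵖ)ᵒᵖ := F
  let c' : Cone F' := c
  have hc' : IsLimit c' := hc
  let t' : c'.pt ⟶ op (Ind.yoneda.obj (op X)) := t
  obtain ⟨n, s, hs⟩ := exists_lift_of_isColimit (F := F'.unop) (c := coconeUnopOfCone c')
    (isColimitCoconeUnopOfCone _ hc') (X := op X) t'.unop
  exact ⟨n, s.op, congrArg Quiver.Hom.op hs⟩

end Pro

/-! ### Generalized elements of `MI` -/

section Quot

variable {R : Type w} [CommRing R] [IsNoetherianRing R]
variable {D : Type u} [Category.{v} D] [Abelian D] [Linear R D]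

/-- A morphism that kills the generalized elements killed by an epimorphism `e` factors through
`e`. -/
theorem exists_desc_of_epi {M E T : D} (e : M ⟶ E) [Epi e] (f : M ⟶ T)
    (h : ∀ (A : D) (y : A ⟶ M), y ≫ e = 0 → y ≫ f = 0) : ∃ d : E ⟶ T, e ≫ d = f :=
  ⟨Abelian.epiDesc e f (h _ _ (kernel.condition e)), Abelian.comp_epiDesc _ _ _⟩

theorem nonempty_iso_of_comp_eq {D : Type u} [Category.{v} D] {M E E' : D}
    {e : M ⟶ E} [Epi e] {e' : M ⟶ E'} [Epi e'] {d : E ⟶ E'} (hd : e ≫ d = e') {d' : E' ⟶ E}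
    (hd' : e' ≫ d' = e) : Nonempty (E ≅ E') :=
  ⟨⟨d, d', by rw [← cancel_epi e, reassoc_of% hd, hd', Category.comp_id],
    by rw [← cancel_epi e', reassoc_of% hd', hd, Category.comp_id]⟩⟩

theorem nonempty_iso_of_epi {M E E' : D} (e : M ⟶ E) [Epi e] (e' : M ⟶ E') [Epi e']
    (h : ∀ (A : D) (y : A ⟶ M), y ≫ e = 0 ↔ y ≫ e' = 0) : Nonempty (E ≅ E') := by
  obtain ⟨d, hd⟩ := exists_desc_of_epi e e' fun A y => (h A y).1
  obtain ⟨d', hd'⟩ := exists_desc_of_epi e' e fun A y => (h A y).2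
  exact nonempty_iso_of_comp_eq hd hd'

theorem genMap_quotπ (I : Ideal R) (M : D) : genMap I M ≫ quotπ I M = 0 :=
  cokernel.condition _

/-- A morphism that is annihilated by `I` kills the elements of `MI`. -/
theorem comp_eq_zero_of_comp_quotπ {I : Ideal R} {A M T : D} {x : A ⟶ M}
    (hx : x ≫ quotπ I M = 0) (f : M ⟶ T) (hf : ∀ r ∈ I, r • f = 0) : x ≫ f = 0 := by
  rw [← quotπ_desc f hf, reassoc_of% hx, zero_comp]

theorem comp_quotπ_of_le {I I' : Ideal R} (h : I ≤ I') {A M : D} {x : A ⟶ M}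
    (hx : x ≫ quotπ I M = 0) : x ≫ quotπ I' M = 0 :=
  comp_eq_zero_of_comp_quotπ hx _ fun _ hr => smul_quotπ M (h hr)

theorem comp_comp_quotπ {I : Ideal R} {A M N : D} {x : A ⟶ M}
    (hx : x ≫ quotπ I M = 0) (f : M ⟶ N) : x ≫ f ≫ quotπ I N = 0 :=
  comp_eq_zero_of_comp_quotπ hx _ fun _ hr => by
    rw [← Linear.comp_smul, smul_quotπ N hr, comp_zero]

theorem smul_comp_quotπ {I I' : Ideal R} {r : R} (h : ∀ s ∈ I, s * r ∈ I') {A M : D} {x : A ⟶ M}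
    (hx : x ≫ quotπ I M = 0) : (r • x) ≫ quotπ I' M = 0 := by
  rw [Linear.smul_comp, ← Linear.comp_smul]
  exact comp_eq_zero_of_comp_quotπ hx _ fun s hs => by
    rw [smul_smul, smul_quotπ M (h s hs)]

theorem smul_eq_zero_of_genMap_comp {I : Ideal R} {M T : D} {f : M ⟶ T} (hf : genMap I M ≫ f = 0)
    {r : R} (hr : r ∈ I) : r • f = 0 := by
  obtain ⟨d, h⟩ : ∃ d : quot I M ⟶ T, quotπ I M ≫ d = f :=
    ⟨cokernel.desc _ f hf, cokernel.π_desc _ _ _⟩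
  rw [← h, ← Linear.smul_comp, smul_quotπ M hr, zero_comp]

theorem quotπ_top (M : D) : quotπ (⊤ : Ideal R) M = 0 := by
  simpa using smul_quotπ M (Submodule.mem_top (x := (1 : R)))

/-- The map `M/MI ⟶ N/NI` induced by a morphism `M ⟶ N`. -/
def quotMap (I : Ideal R) {M N : D} (f : M ⟶ N) : quot I M ⟶ quot I N :=
  quotDesc (f ≫ quotπ I N) fun r hr => by rw [← Linear.comp_smul, smul_quotπ N hr, comp_zero]

@[simp]
theorem quotπ_quotMap (I : Ideal R) {M N : D} (f : M ⟶ N) :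
    quotπ I M ≫ quotMap I f = f ≫ quotπ I N :=
  quotπ_desc _ _

theorem comp_quotπ_eq_zero_iff {I : Ideal R} {A M : D} (x : A ⟶ M) :
    x ≫ quotπ I M = 0 ↔ ∃ (A' : D) (p : A' ⟶ A) (_ : Epi p) (w : A' ⟶ ⨁ fun _ : gens I => M),
      p ≫ x = w ≫ genMap I M :=
  CokernelCofork.IsColimit.comp_π_eq_zero_iff_up_to_refinements (cokernelIsCokernel (genMap I M)) x

/-- For an epimorphism `g : N ⟶ Q`, every element of `QI` lifts to an element of `NI`, up to
refinement. -/
theorem exists_lift_of_comp_quotπ {I : Ideal R} {A N Q : D} (g : N ⟶ Q) [Epi g] {x : A ⟶ Q}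
    (hx : x ≫ quotπ I Q = 0) : ∃ (A' : D) (p : A' ⟶ A) (_ : Epi p) (z : A' ⟶ N),
      p ≫ x = z ≫ g ∧ z ≫ quotπ I N = 0 := by
  obtain ⟨A₁, p, _, w, hw⟩ := (comp_quotπ_eq_zero_iff x).1 hx
  obtain ⟨A₂, q, _, w', hw'⟩ := surjective_up_to_refinements_of_epi
    (biproduct.map fun _ : gens I => g) w
  refine ⟨A₂, q ≫ p, inferInstance, w' ≫ genMap I N, ?_, ?_⟩
  · rw [Category.assoc, hw, reassoc_of% hw', Category.assoc]
    congr 1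
    apply biproduct.hom_ext'
    intro r
    simp [genMap]
  · rw [Category.assoc, genMap_quotπ, comp_zero]

/-- If `I' = (r) + I`, then an element of `MI'` is, up to refinement, of the form `r y + z` with `z`
in `MI`. -/
theorem exists_smul_of_comp_quotπ {I I' : Ideal R} {r : R} (h : I' ≤ Ideal.span {r} ⊔ I) {A M : D}
    {x : A ⟶ M} (hx : x ≫ quotπ I' M = 0) : ∃ (A' : D) (p : A' ⟶ A) (_ : Epi p) (y : A' ⟶ M),
      (p ≫ x - r • y) ≫ quotπ I M = 0 := by
  have key : ∀ s ∈ I', s • (quotπ I M ≫ cokernel.π (r • quotπ I M)) = 0 := by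
    have hr : r • (quotπ I M ≫ cokernel.π (r • quotπ I M)) = 0 := by
      rw [← Linear.smul_comp, cokernel.condition]
    intro s hs
    obtain ⟨a, ha, b, hb, rfl⟩ := Submodule.mem_sup.1 (h hs)
    obtain ⟨c, rfl⟩ := Ideal.mem_span_singleton'.1 ha
    rw [add_smul, mul_smul, hr, smul_zero, zero_add, ← Linear.smul_comp, smul_quotπ M hb, zero_comp]
  have h0 := comp_eq_zero_of_comp_quotπ hx _ key
  rw [← Category.assoc] at h0
  obtain ⟨A', p, hp, y, hy⟩ := (CokernelCofork.IsColimit.comp_π_eq_zero_iff_up_to_refinements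
    (cokernelIsCokernel (r • quotπ I M)) (x ≫ quotπ I M)).1 h0
  refine ⟨A', p, hp, y, ?_⟩
  rw [Preadditive.sub_comp, Category.assoc, hy, Linear.smul_comp, Linear.comp_smul, sub_self]

end Quot

/-! ### Separated objects and completeness -/

section Separated

variable {R : Type w} [CommRing R] [IsNoetherianRing R] {J : Ideal R}
variable {D : Type u} [Category.{v} D] [Abelian D] [Linear R D]

/-- An object `M` is `J`-adically separated if the intersection of the subobjects `MJⁿ` is zero,
expressed in terms of generalized elements `A ⟶ M`. -/
def IsSeparated (J : Ideal R) (M : D) : Prop :=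
  ∀ ⦃A : D⦄ (x : A ⟶ M), (∀ n : ℕ, x ≫ quotπ (J ^ n) M = 0) → x = 0

theorem IsSeparated.of_mono {M N : D} (hN : IsSeparated J N) (f : M ⟶ N) [Mono f] :
    IsSeparated J M := fun A x hx => by
  rw [← cancel_mono f, zero_comp]
  exact hN _ fun n => by rw [Category.assoc]; exact comp_comp_quotπ (hx n) f

theorem isSeparated_of_isLimit {M : D} (h : IsLimit (adicCone J M)) : IsSeparated J M :=
  fun _ _ hx => h.hom_ext fun n => (hx n.unop).trans zero_comp.symm

end Separated

section Pro

variable {R : Type w} [CommRing R] [IsNoetherianRing R] {J : Ideal R}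
variable {C : Type u} [Category.{v} C] [Abelian C] [Linear R C] [EssentiallySmall.{v} C]

/-- A separated pro-object is complete. The canonical morphism from `N` to the limit of its adic
tower is monic by hypothesis. It is always epic: a morphism from the limit to an object of `C`
factors through some stage `N/NJⁿ`, which is a quotient of `N`. -/
theorem nonempty_isLimit_adicCone {N : Pro C} (hN : IsSeparated J N) :
    Nonempty (IsLimit (adicCone J N)) := by
  let φ : N ⟶ limit (adicTower J N) := limit.lift _ (adicCone J N)
  let π (n : ℕ) : limit (adicTower J N) ⟶ quot (J ^ n) N := limit.π (adicTower J N) (op n)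
  have hφ (n : ℕ) : φ ≫ π n = quotπ (J ^ n) N := limit.lift_π _ _
  have : Mono φ := Preadditive.mono_of_cancel_zero _ fun x hx => hN x fun n => by
    rw [← hφ, reassoc_of% hx, zero_comp]
  have : Epi φ := Preadditive.epi_of_cancel_zero _ fun u hu => Pro.hom_ext _ _ fun X t => by
    obtain ⟨n, s, hs⟩ : ∃ (n : ℕ) (s : quot (J ^ n) N ⟶ (Pro.of C).obj X), π n ≫ s = u ≫ t :=
      Pro.exists_factor_of_isLimit (limit.isLimit (adicTower J N)) (u ≫ t)
    have h0 : quotπ (J ^ n) N ≫ s = 0 := by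
      rw [← hφ, Category.assoc, hs, reassoc_of% hu, zero_comp]
    rw [← hs, (cancel_epi _).1 (h0.trans comp_zero.symm), comp_zero, zero_comp]
  have : IsIso φ := isIso_of_mono_of_epi _
  exact ⟨IsLimit.ofPointIso (limit.isLimit (adicTower J N)) (i := this)⟩

theorem IsSeparated.exists_pow_smul_eq_zero {N : Pro C} (hN : IsSeparated J N) {X : C}
    (t : N ⟶ (Pro.of C).obj X) : ∃ n : ℕ, ∀ r ∈ J ^ n, r • t = 0 := by
  obtain ⟨h⟩ := nonempty_isLimit_adicCone hN
  obtain ⟨n, s, hs⟩ : ∃ (n : ℕ) (s : quot (J ^ n) N ⟶ (Pro.of C).obj X), quotπ (J ^ n) N ≫ s = t :=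
    Pro.exists_factor_of_isLimit h t
  refine ⟨n, fun r hr => ?_⟩
  rw [← hs, ← Linear.smul_comp, smul_quotπ N hr, zero_comp]

/-- Together with `IsSeparated.exists_pow_smul_eq_zero`, this characterizes separated pro-objects
as those all of whose morphisms to objects of `C` are killed by a power of `J`. -/
theorem isSeparated_of_forall_exists {N : Pro C}
    (h : ∀ (X : C) (t : N ⟶ (Pro.of C).obj X), ∃ n : ℕ, ∀ r ∈ J ^ n, r • t = 0) :
    IsSeparated J N := fun A x hx => Pro.hom_ext _ _ fun X t => by
  obtain ⟨n, hn⟩ := h X t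
  rw [zero_comp]
  exact comp_eq_zero_of_comp_quotπ (hx n) t hn

theorem IsSeparated.of_epi {M N : Pro C} (hM : IsSeparated J M) (f : M ⟶ N) [Epi f] :
    IsSeparated J N := isSeparated_of_forall_exists fun X t => by
  obtain ⟨n, hn⟩ := hM.exists_pow_smul_eq_zero (f ≫ t)
  refine ⟨n, fun r hr => ?_⟩
  rw [← cancel_epi f, Linear.comp_smul, hn r hr, comp_zero]

theorem IsSeparated.biprod {M N : Pro C} (hM : IsSeparated J M) (hN : IsSeparated J N) :
    IsSeparated J (M ⊞ N) := isSeparated_of_forall_exists fun X t => by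
  obtain ⟨m, hm⟩ := hM.exists_pow_smul_eq_zero (biprod.inl ≫ t)
  obtain ⟨n, hn⟩ := hN.exists_pow_smul_eq_zero (biprod.inr ≫ t)
  refine ⟨max m n, fun r hr => biprod.hom_ext' _ _ ?_ ?_⟩
  · rw [Linear.comp_smul, comp_zero]
    exact hm r (Ideal.pow_le_pow_right (le_max_left _ _) hr)
  · rw [Linear.comp_smul, comp_zero]
    exact hn r (Ideal.pow_le_pow_right (le_max_right _ _) hr)

end Pro

/-! ### Closure properties of `C` in `Pro C` -/

section EssImage

open ZeroObject

variable {C : Type u} [Category.{v} C] [Abelian C] [EssentiallySmall.{v} C]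

theorem essImage_cokernel {X Y : Pro C} (f : X ⟶ Y) (hX : (Pro.of C).essImage X)
    (hY : (Pro.of C).essImage Y) : (Pro.of C).essImage (cokernel f) := by
  obtain ⟨X', ⟨i⟩⟩ := hX
  obtain ⟨Y', ⟨j⟩⟩ := hY
  let f' : X' ⟶ Y' := (Pro.of C).preimage (i.hom ≫ f ≫ j.inv)
  exact ⟨cokernel f', ⟨PreservesCokernel.iso (Pro.of C) f' ≪≫
    cokernel.mapIso _ _ i j (by simp [f'])⟩⟩

theorem essImage_kernel {X Y : Pro C} (f : X ⟶ Y) (hX : (Pro.of C).essImage X)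
    (hY : (Pro.of C).essImage Y) : (Pro.of C).essImage (kernel f) := by
  obtain ⟨X', ⟨i⟩⟩ := hX
  obtain ⟨Y', ⟨j⟩⟩ := hY
  let f' : X' ⟶ Y' := (Pro.of C).preimage (i.hom ≫ f ≫ j.inv)
  exact ⟨kernel f', ⟨PreservesKernel.iso (Pro.of C) f' ≪≫
    kernel.mapIso _ _ i j (by simp [f'])⟩⟩

theorem essImage_biproduct {ι : Type w} [Finite ι] {X : ι → Pro C}
    (hX : ∀ i, (Pro.of C).essImage (X i)) : (Pro.of C).essImage (⨁ X) := by
  choose Y e using hX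
  obtain ⟨n, ⟨f⟩⟩ := Finite.exists_equiv_fin ι
  have : PreservesLimitsOfShape (Discrete ι) (Pro.of C) :=
    preservesLimitsOfShape_of_equiv (Discrete.equivalence f.symm) _
  have := preservesBiproductsOfShape_of_preservesProductsOfShape (J := ι) (Pro.of C)
  exact ⟨⨁ Y, ⟨(Pro.of C).mapBiproduct Y ≪≫ biproduct.mapIso fun i => (e i).some⟩⟩

theorem essImage_biprod {X Y : Pro C} (hX : (Pro.of C).essImage X)
    (hY : (Pro.of C).essImage Y) : (Pro.of C).essImage (X ⊞ Y) := by
  obtain ⟨X', ⟨i⟩⟩ := hX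
  obtain ⟨Y', ⟨j⟩⟩ := hY
  have := preservesBinaryBiproducts_of_preservesBinaryProducts (Pro.of C)
  exact ⟨X' ⊞ Y', ⟨(Pro.of C).mapBiprod X' Y' ≪≫ biprod.mapIso i j⟩⟩

theorem essImage_zero {X : Pro C} (hX : IsZero X) : (Pro.of C).essImage X :=
  ⟨0, ⟨((Pro.of C).map_isZero (isZero_zero C)).iso hX⟩⟩

theorem essImage_quot {R : Type w} [CommRing R] [IsNoetherianRing R] [Linear R C] (I : Ideal R)
    {X : Pro C} (hX : (Pro.of C).essImage X) : (Pro.of C).essImage (quot I X) :=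
  essImage_cokernel _ (essImage_biproduct fun _ => hX) hX

end EssImage

/-! ### Monotone families indexed by multidegrees -/

section Combinatorics

/-- The pigeonhole principle behind the finiteness statements below: a sequence `s` in an order with
the ascending chain condition cannot increase strictly along every relation `a m ≤ a n` of a
sequence `a` in a well-quasi-order. -/
theorem not_forall_lt_of_wellQuasiOrdered {α S : Type*} [Preorder α] [WellQuasiOrderedLE α]
    [Preorder S] [WellFoundedGT S] (a : ℕ → α) (s : ℕ → S) :
    ¬ ∀ m n, m < n → a m ≤ a n → s m < s n := fun h => by
  obtain ⟨φ, hφ⟩ := (wellQuasiOrdered_le (α := α)).exists_monotone_subseq a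
  exact not_strictMono_of_wellFoundedGT (s ∘ φ)
    fun m n hmn => h _ _ (φ.strictMono hmn) (hφ m n hmn.le)

variable {σ : Type*} [Finite σ] {S : Type*} [PartialOrder S] [WellFoundedGT S]

/-- A monotone family indexed by multidegrees, in an order with the ascending chain condition, is
generated in bounded degrees: its members in large degrees agree with earlier ones. -/
theorem exists_degree_forall_eq {U : (σ →₀ ℕ) → S} (hU : Monotone U) :
    ∃ d : ℕ, ∀ a : σ →₀ ℕ, d ≤ a.degree → ∃ i b, a = b + Finsupp.single i 1 ∧ U b = U a := by
  by_contra! h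
  choose a had haU using h
  -- Counterexamples `a (d n)` of strictly increasing degrees.
  let d : ℕ → ℕ := fun n => (fun c => (a c).degree + 1)^[n] 0
  have hd : StrictMono fun n => (a (d n)).degree := strictMono_nat_of_lt_succ fun n => by
    have := had (d (n + 1))
    have e : d (n + 1) = (a (d n)).degree + 1 := Function.iterate_succ_apply' _ _ _
    lia
  refine not_forall_lt_of_wellQuasiOrdered (fun n => a (d n)) (fun n => U (a (d n)))
    fun m n hmn hle => ?_
  obtain ⟨c, hc⟩ := exists_add_of_le hle
  have hc0 : c ≠ 0 := by
    rintro rfl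
    exact (hd hmn).ne (by simp [hc])
  obtain ⟨i, hi⟩ := Finsupp.ne_iff.1 hc0
  obtain ⟨c', rfl⟩ := exists_add_of_le (Finsupp.single_le_iff.2 (Nat.one_le_iff_ne_zero.2 hi))
  have e : a (d n) = (a (d m) + c') + Finsupp.single i 1 := by rw [hc]; abel
  exact (hU (le_self_add (a := a (d m)) (b := c'))).trans_lt
    (lt_of_le_of_ne (hU (by rw [e]; exact le_self_add)) (haU _ i _ e))

/-- An ascending chain of monotone families indexed by a well-quasi-order is eventually constant,
uniformly in the index. -/
theorem exists_forall_eq_of_monotone {α : Type*} [Preorder α] [WellQuasiOrderedLE α]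
    {U : ℕ → α → S} (hU : ∀ i j a b, i ≤ j → a ≤ b → U i a ≤ U j b) :
    ∃ i, ∀ j, i ≤ j → ∀ a, U j a = U i a := by
  by_contra! h
  choose j hj a ha using h
  -- Each step from `i n` to `i (n + 1)` is strict at some index, namely `a (i n)`.
  let i : ℕ → ℕ := fun n => j^[n] 0
  have hi (n : ℕ) : i (n + 1) = j (i n) := Function.iterate_succ_apply' _ _ _
  have hmono : Monotone i := monotone_nat_of_le_succ fun n => (hj (i n)).trans_eq (hi n).symm
  refine not_forall_lt_of_wellQuasiOrdered (fun n => a (i n)) (fun n => U (i (n + 1)) (a (i n)))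
    fun m n hmn hle => ?_
  refine (hU _ _ _ _ (hmono hmn) hle).trans_lt ?_
  rw [hi n]
  exact lt_of_le_of_ne (hU _ _ _ _ (hj _) le_rfl) (ha _).symm

/-- With finitely many variables (and at least one), the degree-lexicographic order on monomials has
the order type of `ℕ`. -/
theorem nonempty_degLex_orderIso (σ : Type*) [Finite σ] [Nonempty σ] [LinearOrder σ] :
    Nonempty (DegLex (σ →₀ ℕ) ≃o ℕ) := by
  let : LocallyFiniteOrder (DegLex (σ →₀ ℕ)) := .ofFiniteIcc fun a b =>
    (Finsupp.finite_of_degree_le (ofDegLex b).degree).subset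
      fun _ hx => Finsupp.DegLex.monotone_degree hx.2
  let := LinearLocallyFiniteOrder.succOrder (DegLex (σ →₀ ℕ))
  let := LinearLocallyFiniteOrder.predOrder (DegLex (σ →₀ ℕ))
  have : NoMaxOrder (DegLex (σ →₀ ℕ)) := ⟨fun a =>
    ⟨toDegLex (ofDegLex a + Finsupp.single (Classical.arbitrary σ) 1),
      Finsupp.DegLex.lt_iff.2 (Or.inl (by simp))⟩⟩
  exact ⟨orderIsoNatOfLinearSuccPredArch⟩

end Combinatorics

/-! ### The filtration of a ring by ideals generated by monomials -/

section Monomials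

variable {R : Type*} [CommRing R] {σ : Type*} (r : σ → R)

/-- The monomial `∏ rᵢ ^ aᵢ` in the elements `rᵢ`. -/
def mon (a : σ →₀ ℕ) : R := a.prod fun i n => r i ^ n

@[simp]
theorem mon_zero : mon r 0 = 1 := Finsupp.prod_zero_index

theorem mon_add (a b : σ →₀ ℕ) : mon r (a + b) = mon r a * mon r b :=
  Finsupp.prod_add_index' (fun _ => pow_zero _) fun _ _ _ => pow_add _ _ _

@[simp]
theorem mon_single (i : σ) : mon r (Finsupp.single i 1) = r i := by
  simp [mon]

theorem mon_mem_pow (a : σ →₀ ℕ) : mon r a ∈ Ideal.span (Set.range r) ^ a.degree := by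
  rw [mon, Finsupp.degree_apply, Finsupp.prod, ← Finset.prod_pow_eq_pow_sum]
  exact Ideal.prod_mem_prod fun i _ =>
    Ideal.pow_mem_pow (Ideal.subset_span (Set.mem_range_self i)) _

/-- The `n`-th power of `(rᵢ)ᵢ` is generated by the monomials of degree `n`. -/
theorem span_range_pow_le (n : ℕ) :
    Ideal.span (Set.range r) ^ n ≤ Ideal.span (mon r '' {a | a.degree = n}) := by
  induction n with
  | zero =>
    have h : (1 : R) ∈ Ideal.span (mon r '' {a | a.degree = 0}) :=
      Ideal.subset_span ⟨0, map_zero _, mon_zero r⟩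
    rw [(Ideal.eq_top_iff_one _).2 h]
    exact le_top
  | succ n ih =>
    rw [pow_succ]
    refine (Ideal.mul_mono_left ih).trans ?_
    rw [Ideal.span_mul_span', Ideal.span_le]
    rintro _ ⟨_, ⟨a, ha, rfl⟩, _, ⟨i, rfl⟩, rfl⟩
    refine Ideal.subset_span ⟨a + Finsupp.single i 1, ?_, by simp [mon_add]⟩
    simpa using ha

variable [LinearOrder σ] (e : DegLex (σ →₀ ℕ) ≃o ℕ)

/-- The rank of a monomial in an enumeration of the monomials that is compatible with the
degree-lexicographic order. -/
def rank (a : σ →₀ ℕ) : ℕ := e (toDegLex a)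

/-- The ideal generated by the monomials of rank at least `k`. -/
def monIdeal (k : ℕ) : Ideal R := Ideal.span (mon r '' {a | k ≤ rank e a})

theorem exists_rank_eq (k : ℕ) : ∃ a, rank e a = k :=
  ⟨ofDegLex (e.symm k), e.apply_symm_apply k⟩

variable {e}

theorem rank_lt_of_degree_lt {a b : σ →₀ ℕ} (h : a.degree < b.degree) : rank e a < rank e b :=
  e.lt_iff_lt.2 (Finsupp.DegLex.lt_iff.2 (Or.inl h))

theorem rank_add_lt {a b : σ →₀ ℕ} (h : rank e a < rank e b) (c : σ →₀ ℕ) :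
    rank e (a + c) < rank e (b + c) := by
  refine e.lt_iff_lt.2 ?_
  rw [toDegLex_add, toDegLex_add]
  exact add_lt_add_left (e.lt_iff_lt.1 h) _

variable (e)

theorem monIdeal_zero : monIdeal r e 0 = ⊤ :=
  (Ideal.eq_top_iff_one _).2 (Ideal.subset_span ⟨0, by simp⟩)

theorem monIdeal_antitone : Antitone (monIdeal r e) := fun _ _ h =>
  Ideal.span_mono (Set.image_mono fun _ ha => h.trans ha)

theorem mon_mem_monIdeal (a : σ →₀ ℕ) : mon r a ∈ monIdeal r e (rank e a) :=
  Ideal.subset_span ⟨a, le_refl (rank e a), rfl⟩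

theorem monIdeal_rank_le (a : σ →₀ ℕ) :
    monIdeal r e (rank e a) ≤ Ideal.span {mon r a} ⊔ monIdeal r e (rank e a + 1) := by
  rw [monIdeal, Ideal.span_le]
  rintro _ ⟨b, hb, rfl⟩
  rcases (Set.mem_ofPred.1 hb).eq_or_lt with h | h
  · obtain rfl : a = b := e.injective h
    exact Ideal.mem_sup_left (Ideal.mem_span_singleton_self _)
  · exact Ideal.mem_sup_right (Ideal.subset_span ⟨b, h, rfl⟩)

theorem mul_mon_mem_monIdeal {a c : σ →₀ ℕ} {s : R} (hs : s ∈ monIdeal r e (rank e a + 1)) :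
    s * mon r c ∈ monIdeal r e (rank e (a + c) + 1) := by
  have : monIdeal r e (rank e a + 1) * Ideal.span {mon r c} ≤
      monIdeal r e (rank e (a + c) + 1) := by
    rw [monIdeal, Ideal.span_mul_span', Ideal.span_le]
    rintro _ ⟨_, ⟨b, hb, rfl⟩, _, rfl, rfl⟩
    exact Ideal.subset_span ⟨b + c, rank_add_lt hb c, mon_add _ _ _⟩
  exact this (Ideal.mul_mem_mul hs (Ideal.mem_span_singleton_self _))

theorem mul_mon_mem_monIdeal_of_mem_span {a : σ →₀ ℕ} {s : R}
    (hs : s ∈ Ideal.span (Set.range r)) : s * mon r a ∈ monIdeal r e (rank e a + 1) := by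
  have : Ideal.span (Set.range r) * Ideal.span {mon r a} ≤ monIdeal r e (rank e a + 1) := by
    rw [Ideal.span_mul_span', Ideal.span_le]
    rintro _ ⟨_, ⟨i, rfl⟩, _, rfl, rfl⟩
    refine Ideal.subset_span ⟨Finsupp.single i 1 + a, ?_, by simp [mon_add]⟩
    exact rank_lt_of_degree_lt (by simp)
  exact this (Ideal.mul_mem_mul hs (Ideal.mem_span_singleton_self _))

theorem exists_pow_le_monIdeal (k : ℕ) : ∃ n, Ideal.span (Set.range r) ^ n ≤ monIdeal r e k := by
  obtain ⟨a, rfl⟩ := exists_rank_eq e k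
  refine ⟨a.degree + 1, (span_range_pow_le r _).trans (Ideal.span_mono (Set.image_mono ?_))⟩
  intro b hb
  exact (rank_lt_of_degree_lt (by rw [Set.mem_ofPred.1 hb]; exact Nat.lt_succ_self _)).le

theorem exists_forall_le_degree [Nonempty σ] (n : ℕ) : ∃ k, ∀ a, k ≤ rank e a → n ≤ a.degree := by
  refine ⟨rank e (Finsupp.single (Classical.arbitrary σ) n), fun a ha => ?_⟩
  by_contra! h
  exact absurd ha (not_le.2 (rank_lt_of_degree_lt (by simpa using h)))

theorem exists_monIdeal_le_pow [Nonempty σ] (n : ℕ) :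
    ∃ k, monIdeal r e k ≤ Ideal.span (Set.range r) ^ n := by
  obtain ⟨k, hk⟩ := exists_forall_le_degree e n
  refine ⟨k, Ideal.span_le.2 ?_⟩
  rintro _ ⟨a, ha, rfl⟩
  exact Ideal.pow_le_pow_right (hk a ha) (mon_mem_pow r a)

/-- An ideal of a noetherian ring has a finite generating family, which is taken to be nonempty so
that there are monomials of every degree. -/
theorem exists_span_range_eq [IsNoetherianRing R] (J : Ideal R) :
    ∃ (p : ℕ) (r : Fin (p + 1) → R), Ideal.span (Set.range r) = J := by
  obtain ⟨p, s, hs⟩ := Submodule.fg_iff_exists_fin_generating_family.1 (IsNoetherian.noetherian J)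
  refine ⟨p, Fin.cons 0 s, ?_⟩
  rw [Fin.range_cons, Ideal.span_insert_zero]
  exact hs

end Monomials

/-! ### Kernels as subobjects of an object of `C` -/

section InitialSubobjects

variable {C : Type u} [Category.{v} C] [Abelian C] [EssentiallySmall.{v} C]

/-- The order on kernels in `C` can be tested on generalized elements in `Pro C`, as the embedding
is exact. -/
theorem kernelSubobject_le_iff {X Y Y' : C} (f : X ⟶ Y) (f' : X ⟶ Y') :
    kernelSubobject f ≤ kernelSubobject f' ↔ ∀ ⦃A : Pro C⦄ (y : A ⟶ (Pro.of C).obj X),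
      y ≫ (Pro.of C).map f = 0 → y ≫ (Pro.of C).map f' = 0 := by
  constructor
  · intro h A y hy
    have h' : kernel.ι f ≫ f' = 0 := by
      rw [← kernelSubobject_arrow', Category.assoc, ← Subobject.ofLE_arrow h, Category.assoc,
        kernelSubobject_arrow_comp, comp_zero, comp_zero]
    have hm : y ≫ (Pro.of C).map (Abelian.coimage.π f) = 0 := by
      rw [← cancel_mono ((Pro.of C).map (Abelian.factorThruCoimage f)), Category.assoc,
        ← Functor.map_comp, Abelian.coimage.fac, hy, zero_comp]
    have hd : f' = Abelian.coimage.π f ≫ cokernel.desc _ f' h' := (cokernel.π_desc _ _ _).symm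
    rw [hd, Functor.map_comp, reassoc_of% hm, zero_comp]
  · intro h
    have h0 := h ((Pro.of C).map (kernel.ι f)) (by
      rw [← Functor.map_comp, kernel.condition, Functor.map_zero])
    rw [← Functor.map_comp, Functor.map_eq_zero_iff] at h0
    exact le_kernelSubobject _ _ (by rw [← kernelSubobject_arrow, Category.assoc, h0, comp_zero])

/-- Let `N` have a quotient `X` in `C`. The kernels of morphisms from `N` to objects of `C` that
factor through `X` are, as an ordered family, subobjects of an object of `C`. -/
theorem exists_subobject_family {N X : Pro C} (π : N ⟶ X) [Epi π] (hX : (Pro.of C).essImage X)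
    {ι : Type*} {Y : ι → Pro C} (hY : ∀ i, (Pro.of C).essImage (Y i)) (φ : ∀ i, N ⟶ Y i)
    (hφ : ∀ i ⦃A : Pro C⦄ (y : A ⟶ N), y ≫ π = 0 → y ≫ φ i = 0) :
    ∃ (X' : C) (U : ι → Subobject X'), ∀ i j, U i ≤ U j ↔
      ∀ ⦃A : Pro C⦄ (y : A ⟶ N), y ≫ φ i = 0 → y ≫ φ j = 0 := by
  obtain ⟨X', ⟨eX⟩⟩ := hX
  choose Y' eY using hY
  choose d hd using fun i => exists_desc_of_epi π (φ i) (hφ i)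
  let f (i : ι) : X' ⟶ Y' i := (Pro.of C).preimage (eX.hom ≫ d i ≫ (eY i).some.inv)
  have key (i : ι) ⦃A : Pro C⦄ (y : A ⟶ N) :
      y ≫ φ i = 0 ↔ (y ≫ π ≫ eX.inv) ≫ (Pro.of C).map (f i) = 0 := by
    simp only [f, Functor.map_preimage, Category.assoc, Iso.inv_hom_id_assoc]
    rw [← hd i, ← cancel_mono (eY i).some.inv, zero_comp]
    simp only [Category.assoc]
  refine ⟨X', fun i => kernelSubobject (f i), fun i j => ?_⟩
  rw [kernelSubobject_le_iff]
  constructor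
  · intro h A y hy
    rw [key] at hy ⊢
    exact h _ hy
  · intro h A y hy
    obtain ⟨A', p, _, z, hz⟩ := surjective_up_to_refinements_of_epi (π ≫ eX.inv) y
    rw [← cancel_epi p, comp_zero, reassoc_of% hz, ← Category.assoc, ← Category.assoc,
      Category.assoc z, ← key]
    apply h
    rw [key, ← hz, Category.assoc, hy, comp_zero]

end InitialSubobjects

/-! ### Initial subobjects -/

section ArtinRees

variable {R : Type w} [CommRing R] [IsNoetherianRing R]
variable {σ : Type*} (r : σ → R) [LinearOrder σ] (e : DegLex (σ →₀ ℕ) ≃o ℕ)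

section General

variable {D : Type u} [Category.{v} D] [Abelian D] [Linear R D]

/-- The generalized element `y` of `N` belongs to the initial subobject of the kernel `K` of
`g : N ⟶ Q` in multidegree `a`. With `I` the ideal generated by the monomials of rank greater than
that of `a`, this means that `rᵃ y` belongs to `K + NI`, or equivalently that `rᵃ g(y)` belongs
to `QI`. -/
def InInitial {N Q : D} (g : N ⟶ Q) (a : σ →₀ ℕ) {A : D} (y : A ⟶ N) : Prop :=
  (mon r a • y ≫ g) ≫ quotπ (monIdeal r e (rank e a + 1)) Q = 0

theorem inInitial_iff {N Q : D} (g : N ⟶ Q) (a : σ →₀ ℕ) {A : D} (y : A ⟶ N) :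
    InInitial r e g a y ↔
      y ≫ (mon r a • g ≫ quotπ (monIdeal r e (rank e a + 1)) Q) = 0 := by
  simp [InInitial]

variable {r e}

/-- The initial subobject increases with the multidegree. -/
theorem InInitial.add {N Q : D} {g : N ⟶ Q} {a : σ →₀ ℕ} {A : D} {y : A ⟶ N}
    (hy : InInitial r e g a y) (c : σ →₀ ℕ) : InInitial r e g (a + c) y := by
  have := smul_comp_quotπ (fun s hs => mul_mon_mem_monIdeal r e (c := c) hs) hy
  rwa [smul_smul, mul_comm, ← mon_add] at this

/-- The initial subobject increases with the kernel of `g`. -/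
theorem InInitial.comp {N Q Q' : D} {g : N ⟶ Q} {a : σ →₀ ℕ} {A : D} {y : A ⟶ N}
    (hy : InInitial r e g a y) (h : Q ⟶ Q') : InInitial r e (g ≫ h) a y := by
  simpa [InInitial] using comp_comp_quotπ hy h

/-- The initial subobject contains `NJ`, since `rᵃ J` lies in the ideal generated by the monomials
of rank greater than that of `a`. -/
theorem inInitial_of_comp_quotπ {N Q : D} (g : N ⟶ Q) (a : σ →₀ ℕ) {A : D} {y : A ⟶ N}
    (hy : y ≫ quotπ (Ideal.span (Set.range r)) N = 0) : InInitial r e g a y := by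
  have := comp_comp_quotπ (smul_comp_quotπ
    (fun s hs => mul_mon_mem_monIdeal_of_mem_span r e (a := a) hs) hy) g
  simpa [InInitial] using this

theorem smul_comp_quotπ_of_mem {I : Ideal R} {s : R} (hs : s ∈ I) {A M : D} (x : A ⟶ M) :
    (s • x) ≫ quotπ I M = 0 := by
  rw [Linear.smul_comp, ← Linear.comp_smul, smul_quotπ M hs, comp_zero]

/-- The Artin-Rees step. Let `a = b + eᵢ`, and suppose that the initial subobjects of `K = ker g` in
multidegrees `a` and `b` agree. Then an element `x` of `K` in the step of rank `a` of the filtration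
is congruent, modulo the next step, to `rᵢ w` for an element `w` of `K` in the step of rank `b`. -/
theorem exists_sub_smul_comp_quotπ {N Q : D} {g : N ⟶ Q} [Epi g] {a b : σ →₀ ℕ} {i : σ}
    (hab : a = b + Finsupp.single i 1)
    (h : ∀ ⦃A : D⦄ (y : A ⟶ N), InInitial r e g a y → InInitial r e g b y) {A : D} {x : A ⟶ N}
    (hxg : x ≫ g = 0) (hx : x ≫ quotπ (monIdeal r e (rank e a)) N = 0) :
    ∃ (A' : D) (p : A' ⟶ A) (_ : Epi p) (w : A' ⟶ N), w ≫ g = 0 ∧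
      w ≫ quotπ (monIdeal r e (rank e b)) N = 0 ∧
      (p ≫ x - r i • w) ≫ quotπ (monIdeal r e (rank e a + 1)) N = 0 := by
  obtain ⟨A₁, p₁, _, y, hy⟩ := exists_smul_of_comp_quotπ (monIdeal_rank_le r e a) hx
  have hya : InInitial r e g a y := by
    simpa [InInitial, Preadditive.sub_comp, reassoc_of% hxg] using comp_comp_quotπ hy g
  obtain ⟨A₂, p₂, _, z, hz, hz'⟩ := exists_lift_of_comp_quotπ g (h y hya)
  refine ⟨A₂, p₂ ≫ p₁, inferInstance, mon r b • (p₂ ≫ y) - z, ?_, ?_, ?_⟩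
  · rw [Preadditive.sub_comp, ← hz]
    simp
  · rw [Preadditive.sub_comp, smul_comp_quotπ_of_mem (mon_mem_monIdeal r e b), zero_sub,
      comp_quotπ_of_le (monIdeal_antitone r e (Nat.le_succ _)) hz', neg_zero]
  · have h1 : (p₂ ≫ p₁) ≫ x - r i • (mon r b • (p₂ ≫ y) - z) =
        p₂ ≫ (p₁ ≫ x - mon r a • y) + mon r (Finsupp.single i 1) • z := by
      rw [hab, mon_add, mon_single, mul_comm, Preadditive.comp_sub, smul_sub, smul_smul,
        Linear.comp_smul, Category.assoc]
      abel
    have h2 := smul_comp_quotπ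
      (fun s hs => mul_mon_mem_monIdeal r e (c := Finsupp.single i 1) hs) hz'
    rw [h1, Preadditive.add_comp, Category.assoc, hy, comp_zero, zero_add, hab, h2]

end General

variable {r e}
variable {C : Type u} [Category.{v} C] [Abelian C] [Linear R C] [EssentiallySmall.{v} C]

theorem essImage_quot_of_le {I I' : Ideal R} (h : I ≤ I') {N : Pro C}
    (hN : (Pro.of C).essImage (quot I N)) : (Pro.of C).essImage (quot I' N) := by
  obtain ⟨i⟩ := nonempty_iso_of_epi (quotπ I N ≫ quotπ I' (quot I N)) (quotπ I' N) fun A y => by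
    constructor
    · intro hy
      rw [← Category.assoc] at hy
      obtain ⟨A', p, _, z, hz, hz'⟩ := exists_lift_of_comp_quotπ (quotπ I N) hy
      have h0 : (p ≫ y - z) ≫ quotπ I N = 0 := by
        rw [Preadditive.sub_comp, Category.assoc, hz, sub_self]
      have h1 := comp_quotπ_of_le h h0
      rw [Preadditive.sub_comp, hz', sub_zero, Category.assoc] at h1
      rw [← cancel_epi p, h1, comp_zero]
    · intro hy
      exact comp_comp_quotπ hy _
  exact (essImage_quot I' hN).ofIso i

/-- The initial subobjects attached to a family of morphisms `g i : N ⟶ Q i` embed, as an ordered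
family, in the subobjects of a single object of `C`, namely of `N/NJ`. -/
theorem exists_subobject_inInitial [Finite σ] {J : Ideal R} (hJ : Ideal.span (Set.range r) = J)
    {N : Pro C} (hN : (Pro.of C).essImage (quot J N)) {ι : Type*} {Q : ι → Pro C}
    (hQ : ∀ i n, (Pro.of C).essImage (quot (J ^ n) (Q i))) (g : ∀ i, N ⟶ Q i) :
    ∃ (X : C) (U : ι × (σ →₀ ℕ) → Subobject X), ∀ i j, U i ≤ U j ↔
      ∀ ⦃A : Pro C⦄ (y : A ⟶ N), InInitial r e (g i.1) i.2 y → InInitial r e (g j.1) j.2 y := by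
  subst hJ
  obtain ⟨X, U, hU⟩ := exists_subobject_family (quotπ _ N) hN
    (Y := fun i : ι × (σ →₀ ℕ) => quot (monIdeal r e (rank e i.2 + 1)) (Q i.1))
    (fun i => by
      obtain ⟨n, hn⟩ := exists_pow_le_monIdeal r e (rank e i.2 + 1)
      exact essImage_quot_of_le hn (hQ _ _))
    (fun i => mon r i.2 • g i.1 ≫ quotπ (monIdeal r e (rank e i.2 + 1)) (Q i.1))
    (fun i A y hy => (inInitial_iff r e _ _ _).1 (inInitial_of_comp_quotπ _ _ hy))
  exact ⟨X, U, fun i j => by simp only [hU, ← inInitial_iff]⟩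

end ArtinRees

/-! ### The Artin-Rees property -/

section KernelOfEpi

variable {R : Type w} [CommRing R] [IsNoetherianRing R] {J : Ideal R}
variable {C : Type u} [Category.{v} C] [Abelian C] [Linear R C] [Noetherian.{v, u, v} C]

theorem exists_degree_forall_inInitial {σ : Type*} [Finite σ] [LinearOrder σ] {r : σ → R}
    (e : DegLex (σ →₀ ℕ) ≃o ℕ) (hJ : Ideal.span (Set.range r) = J) {N Q : Pro C} (g : N ⟶ Q)
    (hN : (Pro.of C).essImage (quot J N)) (hQ : ∀ n, (Pro.of C).essImage (quot (J ^ n) Q)) :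
    ∃ d : ℕ, ∀ a : σ →₀ ℕ, d ≤ a.degree → ∃ i b, a = b + Finsupp.single i 1 ∧
      ∀ ⦃A : Pro C⦄ (y : A ⟶ N), InInitial r e g a y → InInitial r e g b y := by
  obtain ⟨X, U, hU⟩ := exists_subobject_inInitial (e := e) hJ hN (fun _ : Unit => hQ) (fun _ => g)
  have hmono : Monotone fun a => U ((), a) := fun a b hab => (hU _ _).2 fun A y hy => by
    obtain ⟨c, rfl⟩ := exists_add_of_le hab
    exact hy.add c
  obtain ⟨d, hd⟩ := exists_degree_forall_eq hmono
  refine ⟨d, fun a ha => ?_⟩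
  obtain ⟨i, b, hab, h⟩ := hd a ha
  exact ⟨i, b, hab, (hU ((), a) ((), b)).1 h.ge⟩

/-- The Artin-Rees property: for each `m`, the intersection of `K = ker g` with some step `N I_k` of
the monomial filtration is contained in `KJᵐ`. -/
theorem exists_forall_comp_quotπ_kernel {σ : Type*} [Finite σ] [Nonempty σ] [LinearOrder σ]
    {r : σ → R} (e : DegLex (σ →₀ ℕ) ≃o ℕ) (hJ : Ideal.span (Set.range r) = J) {N Q : Pro C}
    (g : N ⟶ Q) [Epi g] (hN : (Pro.of C).essImage (quot J N)) (hNs : IsSeparated J N)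
    (hQ : ∀ n, (Pro.of C).essImage (quot (J ^ n) Q)) (m : ℕ) :
    ∃ k, ∀ ⦃A : Pro C⦄ (x : A ⟶ kernel g),
      (x ≫ kernel.ι g) ≫ quotπ (monIdeal r e k) N = 0 → x ≫ quotπ (J ^ m) (kernel g) = 0 := by
  obtain ⟨d, hd⟩ := exists_degree_forall_inInitial e hJ g hN hQ
  induction m with
  | zero =>
    refine ⟨0, fun A x _ => ?_⟩
    rw [pow_zero, Ideal.one_eq_top, quotπ_top, comp_zero]
  | succ m ih =>
    obtain ⟨k₁, hk₁⟩ := ih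
    obtain ⟨a₁, ha₁⟩ := exists_rank_eq e k₁
    -- The bound `a₁.degree + 2` ensures that `b`, of degree one less than `a`, has rank above `k₁`.
    obtain ⟨k₀, hk₀⟩ := exists_forall_le_degree e (max d (a₁.degree + 2))
    -- Iterating the Artin-Rees step moves `x` arbitrarily deep into the filtration, modulo `KJᵐ⁺¹`.
    have step (j : ℕ) : ∀ ⦃A : Pro C⦄ (x : A ⟶ kernel g),
        (x ≫ kernel.ι g) ≫ quotπ (monIdeal r e k₀) N = 0 →
        ∃ (A' : Pro C) (p : A' ⟶ A) (_ : Epi p) (x' : A' ⟶ kernel g),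
          (x' ≫ kernel.ι g) ≫ quotπ (monIdeal r e (k₀ + j)) N = 0 ∧
          (p ≫ x - x') ≫ quotπ (J ^ (m + 1)) (kernel g) = 0 := by
      induction j with
      | zero => exact fun A x hx => ⟨A, 𝟙 A, inferInstance, x, hx, by simp⟩
      | succ j ihj =>
        intro A x hx
        obtain ⟨A₁, p₁, _, x₁, hx₁, hx₁'⟩ := ihj x hx
        obtain ⟨a, ha⟩ := exists_rank_eq e (k₀ + j)
        have had := hk₀ a (by lia)
        obtain ⟨i, b, hab, hb⟩ := hd a ((le_max_left _ _).trans had)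
        have hk₁b : k₁ ≤ rank e b := by
          rw [← ha₁]
          refine (rank_lt_of_degree_lt ?_).le
          have h1 := (le_max_right _ _).trans had
          have h2 : a.degree = b.degree + 1 := by rw [hab]; simp
          lia
        rw [← ha] at hx₁
        obtain ⟨A₂, p₂, _, w, hwg, hw, hxw⟩ := exists_sub_smul_comp_quotπ hab hb
          (by rw [Category.assoc, kernel.condition, comp_zero]) hx₁
        have hwK : kernel.lift g w hwg ≫ quotπ (J ^ m) (kernel g) = 0 := hk₁ _ (by
          rw [kernel.lift_ι]
          exact comp_quotπ_of_le (monIdeal_antitone r e hk₁b) hw)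
        have hri : ∀ s ∈ J ^ m, s * r i ∈ J ^ (m + 1) := fun s hs => by
          rw [pow_succ]
          exact Ideal.mul_mem_mul hs (hJ ▸ Ideal.subset_span (Set.mem_range_self i))
        refine ⟨A₂, p₂ ≫ p₁, inferInstance, p₂ ≫ x₁ - r i • kernel.lift g w hwg, ?_, ?_⟩
        · rw [← add_assoc, ← ha]
          simpa [Preadditive.sub_comp] using hxw
        · have h1 : (p₂ ≫ p₁) ≫ x - (p₂ ≫ x₁ - r i • kernel.lift g w hwg) =
              p₂ ≫ (p₁ ≫ x - x₁) + r i • kernel.lift g w hwg := by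
            rw [Preadditive.comp_sub, Category.assoc]
            abel
          rw [h1, Preadditive.add_comp, Category.assoc, hx₁', comp_zero, zero_add]
          exact smul_comp_quotπ hri hwK
    refine ⟨k₀, fun A x hx => ?_⟩
    -- Since `N/KJᵐ⁺¹`, the cokernel of `f`, is separated, `x` lies in `KJᵐ⁺¹`.
    let f := genMap (J ^ (m + 1)) (kernel g) ≫ kernel.ι g
    have hE : IsSeparated J (cokernel f) := hNs.of_epi (cokernel.π f)
    have hf : ∀ s ∈ J ^ (m + 1), s • (kernel.ι g ≫ cokernel.π f) = 0 := fun s hs =>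
      smul_eq_zero_of_genMap_comp (by rw [← Category.assoc]; exact cokernel.condition f) hs
    have h0 : (x ≫ kernel.ι g) ≫ cokernel.π f = 0 := hE _ fun n => by
      obtain ⟨k, hk⟩ := exists_monIdeal_le_pow r e n
      rw [hJ] at hk
      obtain ⟨A', p, _, x', hx', hpx⟩ := step k x hx
      have h1 := comp_eq_zero_of_comp_quotπ hpx _ hf
      rw [Preadditive.sub_comp, sub_eq_zero] at h1
      have h2 := comp_comp_quotπ (comp_quotπ_of_le
        ((monIdeal_antitone r e (Nat.le_add_left k k₀)).trans hk) hx') (cokernel.π f)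
      rw [← cancel_epi p, comp_zero, ← h2]
      simpa using congrArg (· ≫ quotπ (J ^ n) (cokernel f)) h1
    obtain ⟨A', p, _, w, hw⟩ :=
      (CokernelCofork.IsColimit.comp_π_eq_zero_iff_up_to_refinements (cokernelIsCokernel f) _).1 h0
    refine (comp_quotπ_eq_zero_iff x).2 ⟨A', p, inferInstance, w, ?_⟩
    rw [← cancel_mono (kernel.ι g), Category.assoc, hw, Category.assoc]

theorem essImage_quot_kernel_of_epi {N Q : Pro C} (g : N ⟶ Q) [Epi g]
    (hN : ∀ n, (Pro.of C).essImage (quot (J ^ n) N)) (hNs : IsSeparated J N)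
    (hQ : ∀ n, (Pro.of C).essImage (quot (J ^ n) Q)) (m : ℕ) :
    (Pro.of C).essImage (quot (J ^ m) (kernel g)) := by
  obtain ⟨p, r, hr⟩ := exists_span_range_eq J
  obtain ⟨e⟩ := nonempty_degLex_orderIso (Fin (p + 1))
  obtain ⟨k, hk⟩ := exists_forall_comp_quotπ_kernel e hr g (by simpa using hN 1) hNs hQ m
  obtain ⟨n, hn⟩ := exists_pow_le_monIdeal r e k
  rw [hr] at hn
  let I := monIdeal r e k
  -- The kernel of `K ⟶ K' = ker (N/NI ⟶ Q/QI)` is `K ∩ NI`, which is contained in `KJᵐ`.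
  let c : kernel g ⟶ kernel (quotMap I g) := kernel.lift _ (kernel.ι g ≫ quotπ I N) (by
    rw [Category.assoc, quotπ_quotMap, kernel.condition_assoc, zero_comp])
  have hc : c ≫ kernel.ι (quotMap I g) = kernel.ι g ≫ quotπ I N := kernel.lift_ι _ _ _
  have : Epi c := (epi_iff_surjective_up_to_refinements c).2 fun A y => by
    obtain ⟨A₁, p₁, _, z, hz⟩ := surjective_up_to_refinements_of_epi (quotπ I N)
      (y ≫ kernel.ι (quotMap I g))
    have hzg : (z ≫ g) ≫ quotπ I Q = 0 := by
      rw [Category.assoc, ← quotπ_quotMap, ← Category.assoc, ← hz]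
      simp
    obtain ⟨A₂, p₂, _, z', hz', hz''⟩ := exists_lift_of_comp_quotπ g hzg
    refine ⟨A₂, p₂ ≫ p₁, inferInstance, kernel.lift g (p₂ ≫ z - z') (by
      rw [Preadditive.sub_comp, Category.assoc, hz', sub_self]), ?_⟩
    rw [← cancel_mono (kernel.ι (quotMap I g)), Category.assoc, Category.assoc, Category.assoc, hz,
      hc, kernel.lift_ι_assoc, Preadditive.sub_comp, hz'', sub_zero, Category.assoc]
  have hK : (Pro.of C).essImage (kernel (quotMap I g)) :=
    essImage_kernel _ (essImage_quot_of_le hn (hN n)) (essImage_quot_of_le hn (hQ n))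
  obtain ⟨i⟩ := nonempty_iso_of_epi (c ≫ quotπ (J ^ m) (kernel (quotMap I g)))
    (quotπ (J ^ m) (kernel g)) fun A y => by
    constructor
    · intro hy
      rw [← Category.assoc] at hy
      obtain ⟨A', p, _, z, hz, hz'⟩ := exists_lift_of_comp_quotπ c hy
      have h0 : (p ≫ y - z) ≫ quotπ (J ^ m) (kernel g) = 0 := hk _ (by
        rw [Category.assoc, ← hc, Preadditive.sub_comp, sub_eq_zero, Category.assoc,
          reassoc_of% hz])
      rw [Preadditive.sub_comp, hz', sub_zero, Category.assoc] at h0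
      rw [← cancel_epi p, h0, comp_zero]
    · intro hy
      exact comp_comp_quotπ hy _
  exact (essImage_quot _ hK).ofIso i

end KernelOfEpi

/-! ### The completion is an abelian subcategory -/

section Closure

variable {R : Type w} [CommRing R] [IsNoetherianRing R] {J : Ideal R}
variable {C : Type u} [Category.{v} C] [Abelian C] [Linear R C]

/-- For pro-objects, the completeness condition in the definition of `Ĉ` amounts to
separatedness. -/
theorem completion_iff [EssentiallySmall.{v} C] (M : Pro C) : completion J C M ↔
    (∀ n : ℕ, (Pro.of C).essImage (quot (J ^ n) M)) ∧ IsSeparated J M :=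
  and_congr_right fun _ => ⟨fun ⟨h⟩ => isSeparated_of_isLimit h, nonempty_isLimit_adicCone⟩

theorem completion_cokernel [EssentiallySmall.{v} C] {M N : Pro C} (f : M ⟶ N)
    (hM : completion J C M) (hN : completion J C N) : completion J C (cokernel f) := by
  rw [completion_iff] at hM hN ⊢
  refine ⟨fun n => ?_, hN.2.of_epi (cokernel.π f)⟩
  have hc : f ≫ quotπ (J ^ n) N ≫ cokernel.π (quotMap (J ^ n) f) = 0 := by
    rw [← Category.assoc, ← quotπ_quotMap, Category.assoc, cokernel.condition, comp_zero]
  obtain ⟨i⟩ := nonempty_iso_of_comp_eq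
    (e := quotπ (J ^ n) N ≫ cokernel.π (quotMap (J ^ n) f))
    (e' := cokernel.π f ≫ quotπ (J ^ n) (cokernel f))
    (d := cokernel.desc _ (quotMap (J ^ n) (cokernel.π f)) (by
      rw [← cancel_epi (quotπ (J ^ n) M), ← Category.assoc, quotπ_quotMap, Category.assoc,
        quotπ_quotMap, cokernel.condition_assoc, zero_comp, comp_zero]))
    (by rw [Category.assoc, cokernel.π_desc, quotπ_quotMap])
    (d' := quotDesc (cokernel.desc f _ hc) fun r hr => by
      rw [← cancel_epi (cokernel.π f), Linear.comp_smul, cokernel.π_desc, ← Linear.smul_comp,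
        smul_quotπ _ hr, zero_comp, comp_zero])
    (by rw [Category.assoc, quotπ_desc, cokernel.π_desc])
  exact (essImage_cokernel _ (hM.1 n) (hN.1 n)).ofIso i

theorem completion_of_iso [EssentiallySmall.{v} C] {M N : Pro C} (i : M ≅ N)
    (hM : completion J C M) : completion J C N := by
  rw [completion_iff] at hM ⊢
  refine ⟨fun n => ?_, hM.2.of_mono i.inv⟩
  obtain ⟨j⟩ := nonempty_iso_of_comp_eq (e := quotπ (J ^ n) M) (e' := i.hom ≫ quotπ (J ^ n) N)
    (quotπ_quotMap _ _) (d' := quotMap (J ^ n) i.inv) (by simp)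
  exact (hM.1 n).ofIso j

theorem completion_biprod [EssentiallySmall.{v} C] {M N : Pro C}
    (hM : completion J C M) (hN : completion J C N) : completion J C (M ⊞ N) := by
  rw [completion_iff] at hM hN ⊢
  refine ⟨fun n => ?_, hM.2.biprod hN.2⟩
  obtain ⟨i⟩ := nonempty_iso_of_comp_eq (e := biprod.map (quotπ (J ^ n) M) (quotπ (J ^ n) N))
    (e' := quotπ (J ^ n) (M ⊞ N))
    (d := biprod.desc (quotMap (J ^ n) biprod.inl) (quotMap (J ^ n) biprod.inr))
    (by ext <;> simp)
    (d' := biprod.lift (quotMap (J ^ n) biprod.fst) (quotMap (J ^ n) biprod.snd))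
    (by ext <;> simp)
  exact (essImage_biprod (hM.1 n) (hN.1 n)).ofIso i

theorem completion_of_isZero [EssentiallySmall.{v} C] {M : Pro C} (hM : IsZero M) :
    completion J C M := by
  rw [completion_iff]
  exact ⟨fun n => essImage_zero (IsZero.of_epi (quotπ (J ^ n) M) hM), fun _ _ _ => hM.eq_of_tgt _ _⟩

variable [Noetherian.{v, u, v} C]

theorem completion_kernel_of_epi {M N : Pro C} (f : M ⟶ N) [Epi f]
    (hM : completion J C M) (hN : completion J C N) : completion J C (kernel f) := by
  rw [completion_iff] at hM hN ⊢
  exact ⟨essImage_quot_kernel_of_epi f hM.1 hM.2 hN.1, hM.2.of_mono (kernel.ι f)⟩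

/-- Kernels of arbitrary morphisms are obtained from kernels of epimorphisms, applied to
`N ⟶ coker f`, whose kernel is the image of `f`, and to the projection from `M` to the image. -/
theorem completion_kernel {M N : Pro C} (f : M ⟶ N)
    (hM : completion J C M) (hN : completion J C N) : completion J C (kernel f) := by
  have h : completion J C (Abelian.image f) :=
    completion_kernel_of_epi _ hN (completion_cokernel f hM hN)
  exact completion_of_iso ((kernelCompMono (Abelian.factorThruImage f) (Abelian.image.ι f)).symm ≪≫
    kernelIsoOfEq (Abelian.image.fac f)) (completion_kernel_of_epi _ hM h)

instance : (completion J C).IsClosedUnderIsomorphisms := ⟨completion_of_iso⟩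

instance : (completion J C).ContainsZero := ⟨_, isZero_zero _, completion_of_isZero (isZero_zero _)⟩

instance : (completion J C).IsClosedUnderKernels where
  kernels_le := by
    rintro _ ⟨f, k, hk, hM, hN⟩
    exact completion_of_iso ((kernelIsKernel f).conePointUniqueUpToIso hk)
      (completion_kernel f hM hN)

instance : (completion J C).IsClosedUnderCokernels where
  cokernels_le := by
    rintro _ ⟨f, k, hk, hM, hN⟩
    exact completion_of_iso ((cokernelIsCokernel f).coconePointUniqueUpToIso hk)
      (completion_cokernel f hM hN)

instance : (completion J C).IsClosedUnderBinaryProducts := .mk' (by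
  rintro _ ⟨F, hF⟩
  exact completion_of_iso (biprod.isoProd _ _ ≪≫ HasLimit.isoOfNatIso (diagramIsoPair F).symm)
    (completion_biprod (hF ⟨.left⟩) (hF ⟨.right⟩)))

instance : (completion J C).IsClosedUnderFiniteProducts := .mk'

instance : PreservesFiniteLimits (completion J C).ι :=
  have := (completion J C).preservesKernels_ι
  (completion J C).ι.preservesFiniteLimits_of_preservesKernels

instance : PreservesFiniteColimits (completion J C).ι :=
  have := (completion J C).preservesCokernels_ι
  (completion J C).ι.preservesFiniteColimits_of_preservesCokernels

theorem isAbelianSubcategory_completion : IsAbelianSubcategory (completion J C) where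
  closedUnderIsomorphisms := inferInstance
  abelian := ⟨inferInstance⟩
  preservesFiniteLimits := inferInstance
  preservesFiniteColimits := inferInstance

end Closure

/-! ### The completion is essentially small -/

section Small

variable {R : Type w} [CommRing R] [IsNoetherianRing R] {J : Ideal R}
variable {C : Type u} [Category.{v} C] [Abelian C] [Linear R C] [EssentiallySmall.{v} C]

instance : ObjectProperty.EssentiallySmall.{v} (completion J C) where
  exists_small_le' := by
    let G : SmallModel.{v} C ⥤ Pro C := (equivSmallModel.{v} C).inverse ⋙ Pro.of C
    refine ⟨.ofObj fun F : ℕᵒᵖ ⥤ SmallModel.{v} C => limit (F ⋙ G), inferInstance, ?_⟩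
    rintro M ⟨hM, ⟨h⟩⟩
    have hG (n : ℕᵒᵖ) : G.essImage ((adicTower J M).obj n) := by
      obtain ⟨X, ⟨i⟩⟩ := hM n.unop
      exact ⟨_, ⟨(Pro.of C).mapIso ((equivSmallModel.{v} C).unitIso.app X).symm ≪≫ i⟩⟩
    exact ⟨_, ⟨Functor.essImage.liftFunctor _ G hG⟩, ⟨h.conePointsIsoOfNatIso (limit.isLimit _)
      (Functor.essImage.liftFunctorCompIso _ G hG).symm⟩⟩

end Small

/-! ### The ascending chain condition -/

section Noetherian

variable {R : Type w} [CommRing R] [IsNoetherianRing R] {J : Ideal R}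

/-- If `ker g ⊆ ker (g ≫ h)` have the same initial subobjects and the target of `g` is separated,
then the two kernels are equal. -/
theorem comp_eq_zero_of_inInitial {D : Type u} [Category.{v} D] [Abelian D] [Linear R D]
    {σ : Type*} [Finite σ] [Nonempty σ] [LinearOrder σ] {r : σ → R}
    (e : DegLex (σ →₀ ℕ) ≃o ℕ) (hJ : Ideal.span (Set.range r) = J) {N Q Q' : D} (g : N ⟶ Q) [Epi g]
    (h : Q ⟶ Q') (hQ : IsSeparated J Q)
    (H : ∀ (a : σ →₀ ℕ) ⦃A : D⦄ (y : A ⟶ N), InInitial r e (g ≫ h) a y → InInitial r e g a y)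
    {A : D} (x : A ⟶ N) (hx : x ≫ g ≫ h = 0) : x ≫ g = 0 := by
  have key (k : ℕ) : (x ≫ g) ≫ quotπ (monIdeal r e k) Q = 0 := by
    induction k with
    | zero => rw [monIdeal_zero, quotπ_top, comp_zero]
    | succ k ih =>
      obtain ⟨a, rfl⟩ := exists_rank_eq e k
      obtain ⟨A₁, p₁, _, z, hz, hz'⟩ := exists_lift_of_comp_quotπ g ih
      obtain ⟨A₂, p₂, _, y, hy⟩ := exists_smul_of_comp_quotπ (monIdeal_rank_le r e a) hz'
      have hzh : z ≫ g ≫ h = 0 := by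
        rw [← Category.assoc, ← hz, Category.assoc, Category.assoc, hx, comp_zero]
      have hya : InInitial r e (g ≫ h) a y := by
        simpa [InInitial, Preadditive.sub_comp, hzh, reassoc_of% hzh] using
          comp_comp_quotπ hy (g ≫ h)
      have h1 : (p₂ ≫ z) ≫ g ≫ quotπ (monIdeal r e (rank e a + 1)) Q = 0 := by
        have h2 := comp_comp_quotπ hy g
        have h3 := H a y hya
        simp only [InInitial, Linear.smul_comp, Category.assoc] at h3
        rwa [Preadditive.sub_comp, Linear.smul_comp, h3, sub_zero] at h2
      rw [← cancel_epi (p₂ ≫ p₁), comp_zero, ← h1]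
      simp only [Category.assoc]
      rw [reassoc_of% hz]
  refine hQ _ fun n => ?_
  obtain ⟨k, hk⟩ := exists_monIdeal_le_pow r e n
  exact comp_quotπ_of_le (hJ ▸ hk) (key k)

variable {C : Type u} [Category.{v} C] [Abelian C] [Linear R C] [Noetherian.{v, u, v} C]

/-- An ascending chain of subobjects of `N` in `Ĉ`, given as the kernels of the morphisms `g i`, is
eventually constant. -/
theorem exists_forall_comp_eq_zero {N : Pro C} (hN : completion J C N) {Q : ℕ → Pro C}
    (hQ : ∀ i, completion J C (Q i)) (g : ∀ i, N ⟶ Q i) [∀ i, Epi (g i)]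
    (h : ∀ i j, i ≤ j → ∃ f : Q i ⟶ Q j, g i ≫ f = g j) :
    ∃ i, ∀ j, i ≤ j → ∀ ⦃A : Pro C⦄ (x : A ⟶ N), x ≫ g j = 0 → x ≫ g i = 0 := by
  obtain ⟨p, r, hr⟩ := exists_span_range_eq J
  obtain ⟨e⟩ := nonempty_degLex_orderIso (Fin (p + 1))
  obtain ⟨X, U, hU⟩ := exists_subobject_inInitial (e := e) hr (by simpa using hN.1 1)
    (fun i => (hQ i).1) g
  have hmono : ∀ i j a b, i ≤ j → a ≤ b → U (i, a) ≤ U (j, b) := fun i j a b hij hab =>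
    (hU _ _).2 fun A y hy => by
      obtain ⟨c, rfl⟩ := exists_add_of_le hab
      obtain ⟨f, hf⟩ := h i j hij
      have := (hy.add c).comp f
      rwa [hf] at this
  obtain ⟨i, hi⟩ := exists_forall_eq_of_monotone (U := fun i a => U (i, a)) hmono
  refine ⟨i, fun j hij A x hx => ?_⟩
  obtain ⟨f, hf⟩ := h i j hij
  refine comp_eq_zero_of_inInitial e hr (g i) f ((completion_iff _).1 (hQ i)).2
    (fun a A y hy => ?_) x (by rw [hf, hx])
  rw [hf] at hy
  exact (hU (j, a) (i, a)).1 (hi j hij a).le y hy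

theorem isNoetherianObject_completion (X : (completion J C).FullSubcategory) :
    IsNoetherianObject X := by
  rw [isNoetherianObject_iff_monotone_chain_condition]
  intro f
  let ι (i : ℕ) : (f i : (completion J C).FullSubcategory).obj ⟶ X.obj :=
    (completion J C).ι.map (f i).arrow
  have hι (i : ℕ) : Mono (ι i) := inferInstanceAs (Mono ((completion J C).ι.map (f i).arrow))
  obtain ⟨i, hi⟩ := exists_forall_comp_eq_zero X.property
    (fun i => completion_cokernel (ι i)
      (f i : (completion J C).FullSubcategory).property X.property)
    (fun i => cokernel.π (ι i)) fun i j hij =>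
      ⟨cokernel.desc _ (cokernel.π (ι j)) (by
        have h : ι i = (completion J C).ι.map (Subobject.ofLE _ _ (f.monotone hij)) ≫ ι j := by
          rw [← Functor.map_comp, Subobject.ofLE_arrow]
        rw [h, Category.assoc, cokernel.condition, comp_zero]), cokernel.π_desc _ _ _⟩
  refine ⟨i, fun j hij => le_antisymm (f.monotone hij) ?_⟩
  have h0 := hi j hij (ι j) (cokernel.condition _)
  refine Subobject.le_of_comm ((completion J C).homMk (Abelian.monoLift (ι i) (ι j) h0)) ?_
  apply (completion J C).ι.map_injective
  exact Abelian.monoLift_comp _ _ _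

end Noetherian

end JAdicCompletion

end

theorem proposition2p2p4 {R : Type w} [CommRing R] [IsNoetherianRing R] (J : Ideal R)
    {C : Type u} [Category.{v} C] [Abelian C] [Linear R C] [Noetherian.{v, u, v} C] :
    JAdicCompletion.IsAbelianSubcategory (JAdicCompletion.completion J C) ∧
      Noetherian.{v, max u (v + 1), v} (JAdicCompletion.completion J C).FullSubcategory :=
  ⟨JAdicCompletion.isAbelianSubcategory_completion,
    { isNoetherianObject := JAdicCompletion.isNoetherianObject_completion }⟩
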